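/- **Theorem (existence and uniqueness of the closed orbit $\widetilde{\mathcal E}(VII_h)$).** Let $\Sigma_+^*\in(-1,-1/4)$, $(\lambda^*)^2>1$ and $\gamma\in(0,2)$, and put $A^*=1+\Sigma_+^*$, $N^*=\sqrt{-\Sigma_+^*(1+\Sigma_+^*)}$. Consider the reduced system $$x'=(T+2\Sigma_+^*)x-(A^*+\sqrt3N^*\cos\theta)\rho,\qquad \rho'=2(T-\Sigma_+^*+A^*x-\alpha\cos\theta)\rho,\qquad \theta'=2\alpha(\lambda^*+\sin\theta),$$ where $\alpha=\sqrt3(1-x)N^*$, $V^2=x^2+\rho$, $$T=\frac{[(3\gamma-4)-2(\gamma-1)A^*x](1-V^2)+(2-\gamma)V^2\mathcal S}{1-(\gamma-1)V^2},\qquad V^2\mathcal S=-2\Sigma_+^*x^2+\Sigma_+^*\rho+\sqrt3N^*\rho\cos\theta,$$ on the state space $\{\rho\ge0,\ V^2\le1\}$. Here $\theta$ is an angle, and $\rho,\theta$ are polar coordinates: the state is the point $(x,\rho e^{i\theta})\in\mathbb R\times\mathbb C$, so that $\rho=0$ gives one point for each $x$. A closed periodic orbit is the orbit in the state space of a periodic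 solution that is not an equilibrium point. Then the extremely tilted set $V=1$ is homeomorphic to the 2-sphere $S^2$ and is invariant, and it contains exactly one closed periodic orbit, up to winding number. That is: the set of points traversed is the same for all closed periodic orbits with $V=1$, at least one exists, and there are a periodic solution $c_1$ on it and a period $T_1>0$ of $c_1$ such that, for every non-constant periodic solution $c$ with $V=1$ and every period $T>0$ of $c$, the angle $\theta$ of $c$ changes by $2\pi n$ over one period $T$ for some integer $n\neq0$ (the winding number), $T=|n|\,T_1$, and $c$ is a time translate of $c_1$. -/

import Mathlib

noncomputable section

namespace ReducedTilt

/-- The constant value `A* = 1 + Σ₊*` in the vacuum plane-wave background. -/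
def curvA (σ : ℝ) : ℝ := 1 + σ

/-- The constant value `N* = Σ₋* = √(-Σ₊*(1 + Σ₊*))` in the vacuum plane-wave background
(where also `Σ₁₂* = Σ₁₃* = Σ₂₃* = Ω = 0`). -/
def curvN (σ : ℝ) : ℝ := Real.sqrt (-σ * (1 + σ))

/-- The variables `x = v₁`, `ρ = v₂² + v₃²` and `θ`, where `v₂² - v₃² = ρ cos θ` and
`2 v₂ v₃ = ρ sin θ`. The angle is a real number here; it matters only modulo `2π`, and only
where `ρ ≠ 0`, see `Vars.toState`. -/
structure Vars where
  x : ℝ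
  ρ : ℝ
  θ : ℝ

/-- `V² = v₁² + v₂² + v₃²`. -/
def Vars.Vsq (p : Vars) : ℝ := p.x ^ 2 + p.ρ

/-- The point of the state space with coordinates `(x, ρ, θ)`: the pair
`(x, ρ e^{iθ}) = (v₁, (v₂ + i v₃)²)`. All angles give the same point when `ρ = 0`. -/
def Vars.toState (p : Vars) : ℝ × ℂ := (p.x, (p.ρ : ℂ) * Complex.exp ((p.θ : ℂ) * Complex.I))

/-- `V² 𝒮 = Σ_{ab} v^a v^b` for the shear
`Σ_{ab} = diag(-2Σ₊*, Σ₊* + √3 Σ₋*, Σ₊* - √3 Σ₋*)`, with `Σ₋* = N*`. -/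
def VsqS (σ : ℝ) (p : Vars) : ℝ :=
  -2 * σ * p.x ^ 2 + σ * p.ρ + Real.sqrt 3 * curvN σ * (p.ρ * Real.cos p.θ)

/-- The function `T`; its denominator is positive when `0 < γ < 2` and `V² ≤ 1`. -/
def tiltT (σ γ : ℝ) (p : Vars) : ℝ :=
  (((3 * γ - 4) - 2 * (γ - 1) * curvA σ * p.x) * (1 - p.Vsq) + (2 - γ) * VsqS σ p)
    / (1 - (γ - 1) * p.Vsq)

/-- `α = √3 (1 - x) N*`. -/
def tiltAlpha (σ : ℝ) (p : Vars) : ℝ := Real.sqrt 3 * (1 - p.x) * curvN σ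

/-- `c` is a (complete) solution curve of the reduced tilt system with parameters
`σ = Σ₊*`, `lam = λ*` and `γ`, inside the physical region `0 ≤ ρ`, `V² ≤ 1`. -/
structure IsSolution (σ lam γ : ℝ) (c : ℝ → Vars) : Prop where
  rho_nonneg : ∀ τ, 0 ≤ (c τ).ρ
  Vsq_le_one : ∀ τ, (c τ).Vsq ≤ 1
  x_eq : ∀ τ, HasDerivAt (fun t => (c t).x)
    ((tiltT σ γ (c τ) + 2 * σ) * (c τ).x
      - (curvA σ + Real.sqrt 3 * curvN σ * Real.cos (c τ).θ) * (c τ).ρ) τ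
  rho_eq : ∀ τ, HasDerivAt (fun t => (c t).ρ)
    (2 * (tiltT σ γ (c τ) - σ + curvA σ * (c τ).x
      - tiltAlpha σ (c τ) * Real.cos (c τ).θ) * (c τ).ρ) τ
  theta_eq : ∀ τ, HasDerivAt (fun t => (c t).θ)
    (2 * tiltAlpha σ (c τ) * (lam + Real.sin (c τ).θ)) τ

/-- `c` is a closed properly periodic solution curve and `T > 0` is one of its periods (not
necessarily the least one). Periodicity is that of the point of the state space, so `θ` may
change by a multiple of `2π`; properly periodic means that the curve is not an equilibrium point. -/
structure IsProperlyPeriodic (σ lam γ : ℝ) (c : ℝ → Vars) (T : ℝ) : Prop where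
  sol : IsSolution σ lam γ c
  pos : 0 < T
  periodic : ∀ τ, (c (τ + T)).toState = (c τ).toState
  proper : ∃ τ, (c τ).toState ≠ (c 0).toState

/-- The closed periodic orbits, as subsets of the state space. -/
def IsClosedOrbit (σ lam γ : ℝ) (O : Set (ℝ × ℂ)) : Prop :=
  ∃ c T, IsProperlyPeriodic σ lam γ c T ∧ O = Set.range (fun τ => (c τ).toState)

/-- The extremely tilted set `V = 1` in the state space: `x² + |ρ e^{iθ}| = 1`. -/
def extremelyTilted : Set (ℝ × ℂ) := {s | s.1 ^ 2 + ‖s.2‖ = 1}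

end ReducedTilt

end

namespace ReducedTilt

open Real Set Filter Topology

/-! On `V = 1` one has `ρ = 1 - x²` and `T = V²𝒮`, so `γ` drops out and a planar system in `(x, θ)`
remains. Write `σ = Σ₊*`, `k = √3 N*`. Dividing `(1 - x)/(1 + x)` by `λ + sin θ` cancels the `cos θ`
term: `q = (1 - x)/((1 + x)(λ + sin θ))` satisfies, as a function of `θ`, a scalar linear equation
with `2π`-periodic coefficients. Since `1 + 4σ < 0` and `λ + sin θ` has constant sign, its
multiplier is not 1, and it has a periodic solution `Q` of the sign that gives `|x| < 1`
(`exists_periodic_profile`).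

Along any solution `d = q - Q(θ)` satisfies `d' = (1 + 4σ)(1 - x) d`, so `d²` decreases strictly
unless it vanishes; periodicity forces `d = 0` (`profile_eq_of_periodic`). On the profile, `θ' =
f(θ)` is autonomous with `f` periodic and nowhere zero. Its time map `G` satisfies `G(θ + 2π) = G(θ)
+ r`, so two solutions differ by a time shift and winding number `n` takes time `n r`
(`exists_tilted_periodic`). -/

/-! ### Scalar linear differential equations. -/

theorem eq_zero_of_linear_ode {a g : ℝ → ℝ} (ha : Continuous a)
    (hg : ∀ t, HasDerivAt g (a t * g t) t) {t₀ : ℝ} (h0 : g t₀ = 0) (t : ℝ) : g t = 0 := by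
  have hP : ∀ t, HasDerivAt (fun t => ∫ s in (0 : ℝ)..t, a s) (a t) t := fun t =>
    (ha.integral_hasStrictDerivAt 0 t).hasDerivAt
  have hd : ∀ t, HasDerivAt (fun t => g t * exp (-∫ s in (0 : ℝ)..t, a s)) 0 t := by
    intro t
    refine ((hg t).mul (hP t).neg.exp).congr_deriv ?_
    simp only [Pi.neg_apply]
    ring
  have := is_const_of_deriv_eq_zero (fun t => (hd t).differentiableAt) (fun t => (hd t).deriv) t t₀
  simp only [h0, zero_mul, mul_eq_zero, exp_ne_zero, or_false] at this
  exact this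

theorem integral_add_period {a : ℝ → ℝ} (ha : Continuous a) {p : ℝ} (hp : a.Periodic p) (t : ℝ) :
    ∫ s in (0 : ℝ)..(t + p), a s = (∫ s in (0 : ℝ)..t, a s) + ∫ s in (0 : ℝ)..p, a s := by
  rw [← intervalIntegral.integral_add_adjacent_intervals (ha.intervalIntegrable 0 t)
    (ha.intervalIntegrable t (t + p)), hp.intervalIntegral_add_eq t 0, zero_add]

/-- A scalar linear equation with periodic coefficients and nontrivial multiplier has a periodic
solution, of definite sign if the inhomogeneity is positive. -/
theorem exists_periodic_linear_ode {a b : ℝ → ℝ} {p : ℝ} (ha : Continuous a) (hb : Continuous b)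
    (hp : 0 < p) (hap : a.Periodic p) (hbp : b.Periodic p) (hb0 : ∀ t, 0 < b t)
    (hL : ∫ s in (0 : ℝ)..p, a s ≠ 0) :
    ∃ Q : ℝ → ℝ, (∀ t, HasDerivAt Q (a t * Q t + b t) t) ∧ Q.Periodic p ∧
      ∀ t, (∫ s in (0 : ℝ)..p, a s) * Q t < 0 := by
  set L := ∫ s in (0 : ℝ)..p, a s with hLdef
  set P : ℝ → ℝ := fun t => ∫ s in (0 : ℝ)..t, a s with hPdef
  have hP : ∀ t, HasDerivAt P (a t) t := fun t => (ha.integral_hasStrictDerivAt 0 t).hasDerivAt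
  have hPp : ∀ t, P (t + p) = P t + L := integral_add_period ha hap
  have hPc : Continuous P := continuous_iff_continuousAt.2 fun t => (hP t).continuousAt
  set w : ℝ → ℝ := fun t => exp (-P t) * b t with hw
  have hwc : Continuous w := by fun_prop
  have hw0 : ∀ t, 0 < w t := fun t => mul_pos (exp_pos _) (hb0 t)
  have hwp : ∀ t, w (t + p) = exp (-L) * w t := by
    intro t
    simp only [hw, hPp, hbp t, neg_add, exp_add]
    ring
  set B : ℝ → ℝ := fun t => ∫ s in (0 : ℝ)..t, w s with hBdef
  have hB : ∀ t, HasDerivAt B (w t) t := fun t => (hwc.integral_hasStrictDerivAt 0 t).hasDerivAt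
  have hBsub : ∀ s t, B t - B s = ∫ u in s..t, w u := fun s t =>
    intervalIntegral.integral_interval_sub_left (hwc.intervalIntegrable _ _)
      (hwc.intervalIntegrable _ _)
  have hBp : ∀ t, B (t + p + p) - B (t + p) = exp (-L) * (B (t + p) - B t) := by
    intro t
    rw [hBsub, hBsub, ← intervalIntegral.integral_comp_add_right,
      ← intervalIntegral.integral_const_mul]
    simp only [hwp]
  have hBpos : ∀ t, 0 < B (t + p) - B t := by
    intro t
    rw [hBsub]
    exact intervalIntegral.intervalIntegral_pos_of_pos (hwc.intervalIntegrable _ _) hw0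
      (by linarith)
  have hc : exp (-L) - 1 ≠ 0 := by
    rw [sub_ne_zero, Ne, exp_eq_one_iff, neg_eq_zero]
    exact hL
  -- Variation of constants gives `exp (P t) * (C + B t)`. Periodicity forces `C + B t = (B (t + p)
  -- - B t) / (exp (-L) - 1)`, a form in which the sign is visible.
  refine ⟨fun t => (exp (-L) - 1)⁻¹ * (exp (P t) * (B (t + p) - B t)), fun t => ?_, fun t => ?_,
    fun t => ?_⟩
  · have h1 := (((hP t).exp).mul (((hB (t + p)).comp_add_const t p).sub (hB t))).const_mul
      (exp (-L) - 1)⁻¹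
    refine h1.congr_deriv ?_
    have he : exp (P t) * exp (-P t) = 1 := by rw [← exp_add, add_neg_cancel, exp_zero]
    rw [hwp]
    simp only [hw, Pi.sub_apply]
    field_simp
    linear_combination (b t * (exp (-L) - 1)) * he
  · have he : exp L * exp (-L) = 1 := by rw [← exp_add, add_neg_cancel, exp_zero]
    simp only [hBp, hPp, exp_add]
    linear_combination ((exp (-L) - 1)⁻¹ * exp (P t) * (B (t + p) - B t)) * he
  · have h1 : 0 < exp (P t) * (B (t + p) - B t) := mul_pos (exp_pos _) (hBpos t)
    have h2 : L * (exp (-L) - 1)⁻¹ < 0 := by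
      rcases lt_or_gt_of_ne hL with h | h
      · exact mul_neg_of_neg_of_pos h (inv_pos.2 (by simpa using h))
      · exact mul_neg_of_pos_of_neg h (inv_lt_zero.2 (by simpa using h))
    rw [← mul_assoc]
    exact mul_neg_of_neg_of_pos h2 h1

/-! ### Periodic autonomous equations on the line. -/

theorem sub_int_mul_of_add_const {G : ℝ → ℝ} {p r : ℝ} (h : ∀ t, G (t + p) = G t + r) (n : ℤ)
    (t : ℝ) : G (t + p * n) = G t + n * r := by
  induction n with
  | zero => simp
  | succ n ih =>
    have := h (t + p * n)
    push_cast at ih ⊢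
    rw [mul_add, mul_one, ← add_assoc, this, ih]
    ring
  | pred n ih =>
    have := h (t + p * (-n - 1))
    push_cast at ih ⊢
    rw [show t + p * (-(n : ℝ) - 1) + p = t + p * -n by ring, ih] at this
    linarith

/-- The flow of a nowhere vanishing periodic vector field on the line: the complete solution
`Θ`, its inverse `G` (the time map) and the transit time `r` of one period. -/
theorem exists_flow_of_pos {f : ℝ → ℝ} {p : ℝ} (hf : Continuous f) (hp : 0 < p)
    (hfp : f.Periodic p) (hf0 : ∀ t, 0 < f t) :
    ∃ (Θ G : ℝ → ℝ) (r : ℝ), 0 < r ∧ (∀ t, HasDerivAt Θ (f (Θ t)) t) ∧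
      (∀ t, HasDerivAt G (f t)⁻¹ t) ∧ (∀ t, Θ (G t) = t) ∧ (∀ t, G (Θ t) = t) ∧
      ∀ t, G (t + p) = G t + r := by
  have hic : Continuous fun t => (f t)⁻¹ := hf.inv₀ fun t => (hf0 t).ne'
  set G : ℝ → ℝ := fun t => ∫ s in (0 : ℝ)..t, (f s)⁻¹ with hGdef
  have hG : ∀ t, HasDerivAt G (f t)⁻¹ t := fun t => (hic.integral_hasStrictDerivAt 0 t).hasDerivAt
  have hGp : ∀ t, G (t + p) = G t + ∫ s in (0 : ℝ)..p, (f s)⁻¹ :=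
    integral_add_period hic fun t => by simp only [hfp t]
  set r := ∫ s in (0 : ℝ)..p, (f s)⁻¹ with hr
  have hr0 : 0 < r := intervalIntegral.intervalIntegral_pos_of_pos (hic.intervalIntegrable _ _)
    (fun t => inv_pos.2 (hf0 t)) hp
  have hmono : StrictMono G := strictMono_of_deriv_pos fun t => by
    rw [(hG t).deriv]; exact inv_pos.2 (hf0 t)
  have hGc : Continuous G := continuous_iff_continuousAt.2 fun t => (hG t).continuousAt
  have hGn := sub_int_mul_of_add_const hGp
  -- `G` grows by `r > 0` over each period, so its values at consecutive multiples of `p` bracket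
  -- any `y`.
  have hsurj : Function.Surjective G := by
    intro y
    have h1 := hGn ⌊(y - G 0) / r⌋ 0
    have h2 := hGn (⌊(y - G 0) / r⌋ + 1) 0
    have h3 := (le_div_iff₀ hr0).1 (Int.floor_le ((y - G 0) / r))
    have h4 := (div_lt_iff₀ hr0).1 (Int.lt_floor_add_one ((y - G 0) / r))
    push_cast at h2
    exact mem_range_of_exists_le_of_exists_ge hGc
      ⟨0 + p * ⌊(y - G 0) / r⌋, h1.trans_le (by linarith)⟩
      ⟨0 + p * (⌊(y - G 0) / r⌋ + 1), h2.symm ▸ (by linarith)⟩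
  let e := hmono.orderIsoOfSurjective G hsurj
  have he1 : ∀ t, e.symm (G t) = t := fun t => e.symm_apply_apply t
  have he2 : ∀ t, G (e.symm t) = t := fun t => e.apply_symm_apply t
  refine ⟨e.symm, G, r, hr0, fun t => ?_, hG, he1, he2, hGp⟩
  have := HasDerivAt.of_local_left_inverse (f := G) (g := e.symm) (a := t)
    e.symm.continuous.continuousAt (hG _) (inv_ne_zero (hf0 _).ne') (Eventually.of_forall he2)
  simpa using this

theorem exists_flow_of_ne_zero {f : ℝ → ℝ} {p : ℝ} (hf : Continuous f) (hp : 0 < p)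
    (hfp : f.Periodic p) (hf0 : (∀ t, 0 < f t) ∨ ∀ t, f t < 0) :
    ∃ (Θ G : ℝ → ℝ) (r : ℝ), r ≠ 0 ∧ (∀ t, HasDerivAt Θ (f (Θ t)) t) ∧
      (∀ t, HasDerivAt G (f t)⁻¹ t) ∧ (∀ t, Θ (G t) = t) ∧ (∀ t, G (Θ t) = t) ∧
      ∀ t, G (t + p) = G t + r := by
  rcases hf0 with h | h
  · obtain ⟨Θ, G, r, hr, H⟩ := exists_flow_of_pos hf hp hfp h
    exact ⟨Θ, G, r, hr.ne', H⟩
  -- Time reversal: the flow of `-f` run backwards.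
  · obtain ⟨Θ, G, r, hr, h1, h2, h3, h4, h5⟩ := exists_flow_of_pos (f := fun t => -f t) hf.neg hp
      (fun t => by simp only [hfp t]) (fun t => neg_pos.2 (h t))
    refine ⟨fun t => Θ (-t), fun t => -G t, -r, neg_ne_zero.2 hr.ne', fun t => ?_, fun t => ?_,
      fun t => ?_, fun t => ?_, fun t => ?_⟩
    · simpa [Function.comp_def] using (h1 (-t)).comp t (hasDerivAt_neg t)
    · exact (h2 t).neg.congr_deriv (by rw [inv_neg, neg_neg])
    · simpa using h3 t
    · simp [h4]
    · simp only [h5]; ring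

/-! ### Topology of the extremely tilted set. -/

/-- The surface `x² + |w| = 1` in `ℝ × ℂ` is a sphere. -/
theorem nonempty_homeomorph_extremelyTilted :
    Nonempty (extremelyTilted ≃ₜ
      Metric.sphere (0 : EuclideanSpace ℝ (Fin 3)) 1) := by
  have hsph : ∀ v : EuclideanSpace ℝ (Fin 3), v ∈ Metric.sphere (0 : EuclideanSpace ℝ (Fin 3)) 1 ↔
      v 0 ^ 2 + ‖(⟨v 1, v 2⟩ : ℂ)‖ ^ 2 = 1 := by
    intro v
    rw [mem_sphere_zero_iff_norm, ← sq_eq_sq₀ (norm_nonneg _) zero_le_one,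
      EuclideanSpace.norm_sq_eq, Fin.sum_univ_three, ← Complex.normSq_eq_norm_sq,
      Complex.normSq_mk]
    simp only [Real.norm_eq_abs, sq_abs, one_pow]
    ring_nf
  -- The map `z ↦ |z| z` squares the modulus and keeps the argument, hence is injective, unlike the
  -- double cover `z ↦ z²`. A continuous bijection from a compact space to a Hausdorff space is a
  -- homeomorphism.
  let F : Metric.sphere (0 : EuclideanSpace ℝ (Fin 3)) 1 → extremelyTilted := fun v =>
    ⟨(v.1 0, (‖(⟨v.1 1, v.1 2⟩ : ℂ)‖ : ℂ) * ⟨v.1 1, v.1 2⟩), by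
      have := (hsph v.1).1 v.2
      simp only [extremelyTilted, mem_ofPred_eq, norm_mul, Complex.norm_real, norm_norm]
      linarith⟩
  have hFc : Continuous F := by
    have hc : Continuous fun v : Metric.sphere (0 : EuclideanSpace ℝ (Fin 3)) 1 =>
        (⟨v.1 1, v.1 2⟩ : ℂ) := by
      have : (fun v : Metric.sphere (0 : EuclideanSpace ℝ (Fin 3)) 1 => (⟨v.1 1, v.1 2⟩ : ℂ)) =
          fun v => ((v.1 1 : ℝ) : ℂ) + ((v.1 2 : ℝ) : ℂ) * Complex.I := by
        funext v
        exact Complex.mk_eq_add_mul_I _ _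
      rw [this]
      fun_prop
    refine Continuous.subtype_mk (Continuous.prodMk (by fun_prop) ?_) _
    exact (Complex.continuous_ofReal.comp hc.norm).mul hc
  have hFb : Function.Bijective F := by
    constructor
    · intro u v huv
      have h := congrArg Subtype.val huv
      simp only [F, Prod.mk.injEq] at h
      obtain ⟨h0, h1⟩ := h
      have hn := congrArg norm h1
      simp only [norm_mul, Complex.norm_real, norm_norm] at hn
      have hn' : ‖(⟨u.1 1, u.1 2⟩ : ℂ)‖ = ‖(⟨v.1 1, v.1 2⟩ : ℂ)‖ := by
        rw [← sq_eq_sq₀ (norm_nonneg _) (norm_nonneg _), sq, sq, hn]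
      have h2 : (⟨u.1 1, u.1 2⟩ : ℂ) = ⟨v.1 1, v.1 2⟩ := by
        rcases eq_or_ne (‖(⟨u.1 1, u.1 2⟩ : ℂ)‖) 0 with hz | hz
        · exact (norm_eq_zero.1 hz).trans (norm_eq_zero.1 (hn'.symm.trans hz)).symm
        · rw [← hn'] at h1
          exact mul_left_cancel₀ (Complex.ofReal_ne_zero.2 hz) h1
      rw [Complex.mk.injEq] at h2
      apply Subtype.ext
      ext i
      fin_cases i
      exacts [h0, h2.1, h2.2]
    · rintro ⟨⟨x, w⟩, hw⟩
      -- The preimage is `w / √|w|`; the convention `0⁻¹ = 0` covers `w = 0`.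
      set z : ℂ := ((√‖w‖)⁻¹ : ℝ) * w with hz
      have hzn : ‖z‖ = √‖w‖ := by
        rw [hz, norm_mul, Complex.norm_real, norm_inv, Real.norm_of_nonneg (Real.sqrt_nonneg _)]
        rcases eq_or_ne w 0 with h | h
        · simp [h]
        · have : √‖w‖ ≠ 0 := (Real.sqrt_pos.2 (norm_pos_iff.2 h)).ne'
          nth_rewrite 2 [← Real.mul_self_sqrt (norm_nonneg w)]
          field_simp
      have hzz : (‖z‖ : ℂ) * z = w := by
        rw [hzn, hz, ← mul_assoc, ← Complex.ofReal_mul]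
        rcases eq_or_ne w 0 with h | h
        · simp [h]
        · have : √‖w‖ ≠ 0 := (Real.sqrt_pos.2 (norm_pos_iff.2 h)).ne'
          rw [mul_inv_cancel₀ this, Complex.ofReal_one, one_mul]
      refine ⟨⟨!₂[x, z.re, z.im], (hsph _).2 ?_⟩, ?_⟩
      · simp only [extremelyTilted, mem_ofPred_eq] at hw
        change x ^ 2 + ‖z‖ ^ 2 = 1
        rw [hzn, Real.sq_sqrt (norm_nonneg _), hw]
      · exact Subtype.ext (Prod.ext rfl hzz)
  have : CompactSpace (Metric.sphere (0 : EuclideanSpace ℝ (Fin 3)) 1) :=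
    isCompact_iff_compactSpace.1 (isCompact_sphere _ _)
  exact ⟨(Continuous.homeoOfEquivCompactToT2 (f := Equiv.ofBijective F hFb) hFc).symm⟩

/-! ### Invariance of `V = 1` and the system on it. -/

theorem mem_extremelyTilted_iff {p : Vars} (h : 0 ≤ p.ρ) :
    p.toState ∈ extremelyTilted ↔ p.x ^ 2 + p.ρ = 1 := by
  simp [extremelyTilted, Vars.toState, Complex.norm_exp_ofReal_mul_I, abs_of_nonneg h]

theorem tiltT_denom_pos {γ : ℝ} (hγ : γ ∈ Ioo (0 : ℝ) 2) {p : Vars} (h0 : 0 ≤ p.ρ)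
    (h1 : p.Vsq ≤ 1) : 0 < 1 - (γ - 1) * p.Vsq := by
  have h2 : 0 ≤ p.Vsq := add_nonneg (sq_nonneg _) h0
  nlinarith [hγ.1, hγ.2, mul_nonneg h2 hγ.1.le, mul_nonneg (sub_nonneg.2 h1) hγ.1.le]

theorem IsSolution.continuous_x {σ lam γ : ℝ} {c : ℝ → Vars} (h : IsSolution σ lam γ c) :
    Continuous fun t => (c t).x :=
  continuous_iff_continuousAt.2 fun t => (h.x_eq t).continuousAt

theorem IsSolution.continuous_rho {σ lam γ : ℝ} {c : ℝ → Vars} (h : IsSolution σ lam γ c) :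
    Continuous fun t => (c t).ρ :=
  continuous_iff_continuousAt.2 fun t => (h.rho_eq t).continuousAt

theorem IsSolution.continuous_theta {σ lam γ : ℝ} {c : ℝ → Vars} (h : IsSolution σ lam γ c) :
    Continuous fun t => (c t).θ :=
  continuous_iff_continuousAt.2 fun t => (h.theta_eq t).continuousAt

/-- The extremely tilted set is invariant: `1 - V²` satisfies a homogeneous linear equation. -/
theorem IsSolution.Vsq_eq_one {σ lam γ : ℝ} (hγ : γ ∈ Ioo (0 : ℝ) 2) {c : ℝ → Vars}
    (h : IsSolution σ lam γ c) {t₀ : ℝ} (h0 : (c t₀).Vsq = 1) (t : ℝ) : (c t).Vsq = 1 := by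
  have hx := h.continuous_x
  have hr := h.continuous_rho
  have hth := h.continuous_theta
  have hD : ∀ t, 1 - (γ - 1) * (c t).Vsq ≠ 0 := fun t =>
    (tiltT_denom_pos hγ (h.rho_nonneg t) (h.Vsq_le_one t)).ne'
  have hV : Continuous fun t => (c t).Vsq := by simp only [Vars.Vsq]; fun_prop
  have hS : Continuous fun t => VsqS σ (c t) := by simp only [VsqS]; fun_prop
  -- The equations give `(V²)' = 2(T V² - V²𝒮)`. Inserting `T`, the terms in `V²𝒮` combine because
  -- `(2 - γ) + (γ - 1) = 1`, and a factor `1 - V²` splits off, leaving this coefficient.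
  have ha : Continuous fun t => -2 * (((3 * γ - 4) - 2 * (γ - 1) * curvA σ * (c t).x) * (c t).Vsq
      - VsqS σ (c t)) / (1 - (γ - 1) * (c t).Vsq) :=
    Continuous.div (by fun_prop) (by fun_prop) hD
  have hz := eq_zero_of_linear_ode (g := fun t => 1 - (c t).Vsq) ha (fun t => ?_)
    (t₀ := t₀) (by simp [h0]) t
  · linarith
  · have h1 := (((h.x_eq t).pow 2).add (h.rho_eq t)).const_sub 1
    refine h1.congr_deriv ?_
    have hD' := hD t
    simp only [tiltT, tiltAlpha]
    have hS' : VsqS σ (c t) = -2 * σ * (c t).x ^ 2 + σ * (c t).ρ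
      + √3 * curvN σ * ((c t).ρ * cos (c t).θ) := rfl
    have hV' : (c t).ρ = (c t).Vsq - (c t).x ^ 2 := by simp [Vars.Vsq]
    set S := VsqS σ (c t)
    set V := (c t).Vsq
    field_simp
    push_cast
    generalize (c t).x = x at *
    generalize (c t).ρ = r at *
    generalize √3 = k at *
    rw [hS', hV']
    ring

theorem tiltT_eq_VsqS {σ γ : ℝ} (hγ : γ ∈ Ioo (0 : ℝ) 2) {p : Vars} (h : p.Vsq = 1) :
    tiltT σ γ p = VsqS σ p := by
  have h2 : 2 - γ ≠ 0 := by linarith [hγ.2]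
  have hd : 1 - (γ - 1) * 1 = 2 - γ := by ring
  rw [tiltT, h, hd]
  field_simp
  ring

/-- The reduced system on the extremely tilted set, where `ρ = 1 - x²`. -/
theorem IsSolution.hasDerivAt_x_of_tilted {σ lam γ : ℝ} (hγ : γ ∈ Ioo (0 : ℝ) 2) {c : ℝ → Vars}
    (h : IsSolution σ lam γ c) (hV : ∀ t, (c t).x ^ 2 + (c t).ρ = 1) (t : ℝ) :
    HasDerivAt (fun t => (c t).x) ((1 - (c t).x ^ 2) * (3 * σ * (c t).x - (1 + σ)
      - √3 * curvN σ * cos (c t).θ * (1 - (c t).x))) t := by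
  refine (h.x_eq t).congr_deriv ?_
  have hr : (c t).ρ = 1 - (c t).x ^ 2 := by linarith [hV t]
  simp only [tiltT_eq_VsqS hγ (hV t), VsqS, curvA, hr]
  ring

theorem IsSolution.hasDerivAt_theta {σ lam γ : ℝ} {c : ℝ → Vars}
    (h : IsSolution σ lam γ c) (t : ℝ) :
    HasDerivAt (fun t => (c t).θ)
      (2 * (√3 * curvN σ) * (1 - (c t).x) * (lam + sin (c t).θ)) t := by
  refine (h.theta_eq t).congr_deriv ?_
  simp only [tiltAlpha]
  ring

theorem isSolution_of_tilted {σ lam γ : ℝ} (hγ : γ ∈ Ioo (0 : ℝ) 2) {x θ : ℝ → ℝ}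
    (hx1 : ∀ t, x t ^ 2 ≤ 1)
    (hx : ∀ t, HasDerivAt x ((1 - x t ^ 2) * (3 * σ * x t - (1 + σ)
      - √3 * curvN σ * cos (θ t) * (1 - x t))) t)
    (hθ : ∀ t, HasDerivAt θ (2 * (√3 * curvN σ) * (1 - x t) * (lam + sin (θ t))) t) :
    IsSolution σ lam γ (fun t => ⟨x t, 1 - x t ^ 2, θ t⟩) := by
  have hT : ∀ t, tiltT σ γ ⟨x t, 1 - x t ^ 2, θ t⟩ = VsqS σ ⟨x t, 1 - x t ^ 2, θ t⟩ := fun t =>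
    tiltT_eq_VsqS hγ (by simp [Vars.Vsq])
  refine ⟨fun t => by linarith [hx1 t], fun t => by simp [Vars.Vsq], fun t => ?_, fun t => ?_,
    fun t => ?_⟩
  · refine (hx t).congr_deriv ?_
    simp only [hT, VsqS, curvA]
    ring
  · refine (((hx t).pow 2).const_sub 1).congr_deriv ?_
    simp only [hT, VsqS, curvA, tiltAlpha]
    push_cast
    ring
  · refine (hθ t).congr_deriv ?_
    simp only [tiltAlpha]
    ring

/-! ### The periodic profile and its rigidity. -/

/-- `2λ(λ + sin θ) = (λ² - sin² θ) + (λ + sin θ)²`. Thus `λ + sin θ` never vanishes and has the sign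
of `λ`, which treats both signs of `λ` at once. -/
theorem mul_add_sin_pos {lam : ℝ} (h : 1 < lam ^ 2) (θ : ℝ) : 0 < lam * (lam + sin θ) := by
  nlinarith [sin_sq_le_one θ, sq_nonneg (lam + sin θ)]

/-- In terms of `q = (1 - x) / ((1 + x)(λ + sin θ))` the orbits on the extremely tilted set are
the solutions of a linear equation, which has a periodic solution with `|x| < 1`. -/
theorem exists_periodic_profile {σ lam k : ℝ} (hσ : σ < -1 / 4) (hlam : 1 < lam ^ 2) (hk : 0 < k) :
    ∃ Q : ℝ → ℝ, (∀ θ, HasDerivAt Q ((1 + 4 * σ) / (2 * k * (lam + sin θ)) * Q θ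
        + (1 - 2 * σ) / (2 * k * (lam + sin θ) ^ 2)) θ) ∧
      Q.Periodic (2 * π) ∧ ∀ θ, 0 < (lam + sin θ) * Q θ := by
  have hm := mul_add_sin_pos hlam
  have hne : ∀ θ, lam + sin θ ≠ 0 := fun θ h => by simpa [h] using hm θ
  have ha : Continuous fun θ => (1 + 4 * σ) / (2 * k * (lam + sin θ)) :=
    Continuous.div (by fun_prop) (by fun_prop) fun θ => mul_ne_zero (by positivity) (hne θ)
  have hb : Continuous fun θ => (1 - 2 * σ) / (2 * k * (lam + sin θ) ^ 2) :=
    Continuous.div (by fun_prop) (by fun_prop) fun θ =>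
      mul_ne_zero (by positivity) (pow_ne_zero _ (hne θ))
  -- The logarithm of the multiplier has the sign of `-λ`; here `σ < -1/4` enters.
  have hL : 0 < -lam * ∫ θ in (0 : ℝ)..2 * π, (1 + 4 * σ) / (2 * k * (lam + sin θ)) := by
    rw [← intervalIntegral.integral_const_mul]
    refine intervalIntegral.intervalIntegral_pos_of_pos
      ((ha.const_mul _).intervalIntegrable _ _) (fun θ => ?_) (by positivity)
    have h1 : -lam * ((1 + 4 * σ) / (2 * k * (lam + sin θ)))
        = -(1 + 4 * σ) * (lam * (lam + sin θ)) / (2 * k * (lam + sin θ) ^ 2) := by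
      have := hne θ
      field_simp
    rw [h1]
    have := hne θ
    exact div_pos (mul_pos (by linarith) (hm θ)) (by positivity)
  obtain ⟨Q, hQ, hQp, hQs⟩ := exists_periodic_linear_ode ha hb (by positivity : 0 < 2 * π)
    (fun θ => by simp only [sin_add_two_pi]) (fun θ => by simp only [sin_add_two_pi])
    (fun θ => by
      have := hne θ
      exact div_pos (by linarith) (by positivity))
    (fun h => by simp [h] at hL)
  refine ⟨Q, hQ, hQp, fun θ => ?_⟩
  have h1 := mul_pos (mul_pos hL (neg_pos.2 (hQs θ))) (hm θ)
  have h2 : ∀ I : ℝ, -lam * I * -(I * Q θ) * (lam * (lam + sin θ))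
      = (lam * I) ^ 2 * ((lam + sin θ) * Q θ) := fun I => by ring
  rw [h2] at h1
  exact pos_of_mul_pos_right h1 (sq_nonneg _)

/-- Both terms obey the same linear equation in `θ`, so the inhomogeneity drops out of the
difference; multiplying by `θ'` converts to time and cancels the denominator `2k(λ + sin θ)`. -/
theorem hasDerivAt_profile_sub {σ lam k : ℝ} (hlam : 1 < lam ^ 2) (hk : 0 < k) {Q x θ : ℝ → ℝ}
    (hQ : ∀ θ, HasDerivAt Q ((1 + 4 * σ) / (2 * k * (lam + sin θ)) * Q θ
      + (1 - 2 * σ) / (2 * k * (lam + sin θ) ^ 2)) θ)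
    (hx1 : ∀ t, -1 < x t)
    (hx : ∀ t, HasDerivAt x ((1 - x t ^ 2) * (3 * σ * x t - (1 + σ)
      - k * cos (θ t) * (1 - x t))) t)
    (hθ : ∀ t, HasDerivAt θ (2 * k * (1 - x t) * (lam + sin (θ t))) t) (t : ℝ) :
    HasDerivAt (fun t => (1 - x t) / (1 + x t) / (lam + sin (θ t)) - Q (θ t))
      ((1 + 4 * σ) * (1 - x t) * ((1 - x t) / (1 + x t) / (lam + sin (θ t)) - Q (θ t))) t := by
  have hne : lam + sin (θ t) ≠ 0 := fun h => by simpa [h] using mul_add_sin_pos hlam (θ t)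
  have hx0 : 1 + x t ≠ 0 := by linarith [hx1 t]
  refine ((((hx t).const_sub 1).div ((hx t).const_add 1) hx0).div ((hθ t).sin.const_add lam)
    hne |>.sub ((hQ (θ t)).comp t (hθ t))).congr_deriv ?_
  simp only [Pi.div_apply]
  field_simp
  ring

/-- A periodic solution on the extremely tilted set lies on the periodic profile. -/
theorem profile_eq_of_periodic {σ lam k T : ℝ} {n : ℤ} (hσ : σ < -1 / 4) (hlam : 1 < lam ^ 2)
    (hk : 0 < k) (hT : 0 < T) {Q x θ : ℝ → ℝ}
    (hQ : ∀ θ, HasDerivAt Q ((1 + 4 * σ) / (2 * k * (lam + sin θ)) * Q θ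
      + (1 - 2 * σ) / (2 * k * (lam + sin θ) ^ 2)) θ)
    (hQp : Q.Periodic (2 * π)) (hx1 : ∀ t, -1 < x t) (hx2 : ∀ t, x t < 1)
    (hx : ∀ t, HasDerivAt x ((1 - x t ^ 2) * (3 * σ * x t - (1 + σ)
      - k * cos (θ t) * (1 - x t))) t)
    (hθ : ∀ t, HasDerivAt θ (2 * k * (1 - x t) * (lam + sin (θ t))) t)
    (hxp : ∀ t, x (t + T) = x t) (hθp : ∀ t, θ (t + T) = θ t + 2 * π * n) (t : ℝ) :
    (1 - x t) / (1 + x t) / (lam + sin (θ t)) = Q (θ t) := by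
  have hd := hasDerivAt_profile_sub hlam hk hQ hx1 hx hθ
  set d : ℝ → ℝ := fun t => (1 - x t) / (1 + x t) / (lam + sin (θ t)) - Q (θ t) with hddef
  by_contra hne
  have hne' : d t ≠ 0 := sub_ne_zero.2 hne
  have hdp : d (t + T) = d t := by
    have e1 : Q (θ t + 2 * π * n) = Q (θ t) := by rw [mul_comm]; exact hQp.int_mul n (θ t)
    have e2 : sin (θ t + 2 * π * n) = sin (θ t) := by
      rw [mul_comm]; exact sin_periodic.int_mul n (θ t)
    simp only [hddef, hxp, hθp, e1, e2]
  have hd2 : ∀ s, HasDerivAt (fun s => d s ^ 2) (2 * (1 + 4 * σ) * (1 - x s) * d s ^ 2) s := by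
    intro s
    refine ((hd s).pow 2).congr_deriv ?_
    push_cast
    ring
  have hanti : Antitone fun s => d s ^ 2 :=
    antitone_of_deriv_nonpos (fun s => (hd2 s).differentiableAt) fun s => by
      rw [(hd2 s).deriv]
      have := mul_nonneg (mul_nonneg (by linarith : 0 ≤ -(1 + 4 * σ)) (sub_nonneg.2 (hx2 s).le))
        (sq_nonneg (d s))
      linarith
  -- A monotone function with equal values at both ends of a period is constant in between. Its
  -- one-sided derivative at `t` is then zero, against the strictly negative value from the
  -- equation.
  have hconst : ∀ s ∈ Icc t (t + T), d s ^ 2 = d t ^ 2 := fun s hs => by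
    have h1 := hanti hs.1
    have h2 := hanti hs.2
    simp only [hdp] at h1 h2
    linarith
  have h0 : HasDerivWithinAt (fun s => d s ^ 2) 0 (Icc t (t + T)) t :=
    (hasDerivWithinAt_const t _ (d t ^ 2)).congr hconst rfl
  have hu : UniqueDiffWithinAt ℝ (Icc t (t + T)) t :=
    uniqueDiffOn_Icc (by linarith) t ⟨le_rfl, by linarith⟩
  have h3 := hu.eq_deriv _ (hd2 t).hasDerivWithinAt h0
  have h4 : 0 < -(1 + 4 * σ) * (1 - x t) * d t ^ 2 :=
    mul_pos (mul_pos (by linarith) (sub_pos.2 (hx2 t))) (by positivity)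
  linarith

/-! ### Poles and winding number. -/

theorem toState_eq_iff_of_rho_ne_zero {p q : Vars} (hp : 0 < p.ρ) (hq : 0 ≤ q.ρ) :
    p.toState = q.toState ↔ p.x = q.x ∧ p.ρ = q.ρ ∧ ∃ n : ℤ, p.θ = q.θ + 2 * π * n := by
  simp only [Vars.toState, Prod.mk.injEq]
  refine and_congr_right fun _ => ⟨fun h => ?_, ?_⟩
  · have hn := congrArg norm h
    simp only [norm_mul, Complex.norm_real, Complex.norm_exp_ofReal_mul_I, mul_one,
      Real.norm_eq_abs, abs_of_pos hp, abs_of_nonneg hq] at hn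
    rw [hn] at h
    have h2 := mul_left_cancel₀ (Complex.ofReal_ne_zero.2 (hn ▸ hp.ne')) h
    obtain ⟨n, h3⟩ := Complex.exp_eq_exp_iff_exists_int.1 h2
    refine ⟨hn, n, ?_⟩
    have h4 := congrArg Complex.im h3
    simp at h4
    linarith
  · rintro ⟨h1, n, h2⟩
    rw [h1, h2]
    congr 1
    rw [Complex.exp_eq_exp_iff_exists_int]
    exact ⟨n, by push_cast; ring⟩

/-- The poles `x = ±1` are equilibria in the state space: `ρ` satisfies a homogeneous linear
equation, so one zero makes `ρ` vanish identically and `x` constant, whatever `θ` does. -/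
theorem IsProperlyPeriodic.rho_pos_of_tilted {σ lam γ T : ℝ} (hγ : γ ∈ Ioo (0 : ℝ) 2)
    {c : ℝ → Vars} (h : IsProperlyPeriodic σ lam γ c T)
    (hV : ∀ t, (c t).x ^ 2 + (c t).ρ = 1) (t : ℝ) : 0 < (c t).ρ := by
  refine (h.sol.rho_nonneg t).lt_of_ne' fun h0 => ?_
  have hx := h.sol.hasDerivAt_x_of_tilted hγ hV
  have hxc := h.sol.continuous_x
  have hθc := h.sol.continuous_theta
  have hr : ∀ s, (c s).ρ = 0 := by
    refine eq_zero_of_linear_ode (a := fun s => -2 * (c s).x * (3 * σ * (c s).x - (1 + σ)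
      - √3 * curvN σ * cos (c s).θ * (1 - (c s).x))) (by fun_prop) (fun s => ?_) h0
    have he : (fun s => (c s).ρ) = fun s => 1 - (c s).x ^ 2 := funext fun s => by linarith [hV s]
    have hes : (c s).ρ = 1 - (c s).x ^ 2 := by linarith [hV s]
    rw [he]
    refine (((hx s).pow 2).const_sub 1).congr_deriv ?_
    rw [hes]
    push_cast
    ring
  have hx0 : ∀ s, HasDerivAt (fun t => (c t).x) 0 s := fun s => by
    refine (hx s).congr_deriv ?_
    have hes : 1 - (c s).x ^ 2 = 0 := by linarith [hV s, hr s]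
    rw [hes, zero_mul]
  obtain ⟨s, hs⟩ := h.proper
  refine hs ?_
  have := is_const_of_deriv_eq_zero (fun t => (hx0 t).differentiableAt) (fun t => (hx0 t).deriv) s 0
  simp only [Vars.toState, hr, this, Complex.ofReal_zero, zero_mul]

theorem abs_lt_one_of_tilted {p : Vars} (hV : p.x ^ 2 + p.ρ = 1) (h : 0 < p.ρ) :
    -1 < p.x ∧ p.x < 1 :=
  abs_lt.1 ((sq_lt_one_iff_abs_lt_one _).1 (by linarith))

/-- Over a period of a closed orbit on the extremely tilted set the angle changes by a nonzero
multiple of `2π`. -/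
theorem IsProperlyPeriodic.exists_winding {σ lam γ T : ℝ} (hlam : 1 < lam ^ 2)
    (hγ : γ ∈ Ioo (0 : ℝ) 2) (hk : 0 < √3 * curvN σ) {c : ℝ → Vars}
    (h : IsProperlyPeriodic σ lam γ c T) (hV : ∀ t, (c t).x ^ 2 + (c t).ρ = 1) :
    ∃ n : ℤ, n ≠ 0 ∧ ∀ t, (c (t + T)).θ = (c t).θ + 2 * π * n := by
  have hr := h.rho_pos_of_tilted hγ hV
  have hper : ∀ t, (c (t + T)).x = (c t).x ∧
      ∃ n : ℤ, (c (t + T)).θ = (c t).θ + 2 * π * n := fun t => by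
    have := (toState_eq_iff_of_rho_ne_zero (hr _) (hr _).le).1 (h.periodic t)
    exact ⟨this.1, this.2.2⟩
  have hθ := h.sol.hasDerivAt_theta
  -- `θ'` depends on `θ` only through `sin θ`, so the increment over a period is constant and one
  -- integer serves all times.
  have hd : ∀ t, HasDerivAt (fun t => (c (t + T)).θ - (c t).θ) 0 t := fun t => by
    refine (((hθ (t + T)).comp_add_const t T).sub (hθ t)).congr_deriv ?_
    obtain ⟨h1, n, h2⟩ := hper t
    have h3 : sin ((c t).θ + 2 * π * n) = sin (c t).θ := by
      rw [mul_comm]; exact sin_periodic.int_mul n _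
    rw [h1, h2, h3, sub_self]
  obtain ⟨-, n, hn⟩ := hper 0
  have hall : ∀ t, (c (t + T)).θ = (c t).θ + 2 * π * n := fun t => by
    have := is_const_of_deriv_eq_zero (fun t => (hd t).differentiableAt)
      (fun t => (hd t).deriv) t 0
    simp only [hn] at this
    linarith
  refine ⟨n, ?_, hall⟩
  rintro rfl
  -- `λθ` increases strictly, which rules out winding number zero.
  have hmono : StrictMono fun t => lam * (c t).θ := strictMono_of_deriv_pos fun t => by
    rw [((hθ t).const_mul lam).deriv]
    have h1 := (abs_lt_one_of_tilted (hV t) (hr t)).2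
    have := mul_pos (mul_pos (mul_pos two_pos hk) (sub_pos.2 h1))
      (mul_add_sin_pos hlam (c t).θ)
    linarith
  have h1 := hmono (by linarith [h.pos] : (0 : ℝ) < 0 + T)
  have h2 : (c (0 + T)).θ = (c 0).θ := by simpa using hall 0
  simp only [h2] at h1
  exact lt_irrefl _ h1

/-! ### Construction and uniqueness of the closed orbit. -/

/-- The closed orbit on the extremely tilted set, and the rigidity of periodic solutions there. -/
theorem exists_tilted_periodic {σ lam γ : ℝ} (hσ : σ ∈ Ioo (-1 : ℝ) (-1 / 4))
    (hlam : 1 < lam ^ 2) (hγ : γ ∈ Ioo (0 : ℝ) 2) :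
    ∃ (c₁ : ℝ → Vars) (T₁ : ℝ), IsProperlyPeriodic σ lam γ c₁ T₁ ∧
      (∀ t, (c₁ t).toState ∈ extremelyTilted) ∧
      ∀ (c : ℝ → Vars) (T : ℝ), IsProperlyPeriodic σ lam γ c T →
        (∀ t, (c t).toState ∈ extremelyTilted) →
        ∃ (n : ℤ) (s : ℝ), n ≠ 0 ∧ (∀ t, (c (t + T)).θ = (c t).θ + 2 * π * (n : ℝ)) ∧
          T = |(n : ℝ)| * T₁ ∧ ∀ t, (c t).toState = (c₁ (t + s)).toState := by
  have hk : 0 < √3 * curvN σ := by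
    have : 0 < -σ * (1 + σ) := mul_pos (by linarith [hσ.2]) (by linarith [hσ.1])
    exact mul_pos (by positivity) (Real.sqrt_pos.2 this)
  set k := √3 * curvN σ with hkdef
  obtain ⟨Q, hQ, hQp, hQ0⟩ := exists_periodic_profile hσ.2 hlam hk
  have hm := mul_add_sin_pos hlam
  have hne : ∀ θ, lam + sin θ ≠ 0 := fun θ h => by simpa [h] using hm θ
  have hQc : Continuous Q := continuous_iff_continuousAt.2 fun t => (hQ t).continuousAt
  -- `Z` is `(1 - x)/(1 + x)` on the profile and `X` recovers `x`; `Z > 0` amounts to `|X| < 1`.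
  set Z : ℝ → ℝ := fun θ => (lam + sin θ) * Q θ with hZ
  have hZp : Z.Periodic (2 * π) := fun θ => by simp only [hZ, sin_add_two_pi, hQp θ]
  have hZc : Continuous Z := by fun_prop
  have hZ1 : ∀ θ, 1 + Z θ ≠ 0 := fun θ => by linarith [hQ0 θ]
  set X : ℝ → ℝ := fun θ => (1 - Z θ) / (1 + Z θ) with hX
  have hXp : X.Periodic (2 * π) := fun θ => by simp only [hX, hZp θ]
  have hXc : Continuous X := Continuous.div (by fun_prop) (by fun_prop) hZ1
  have hX1 : ∀ θ, X θ < 1 := fun θ => by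
    rw [hX, div_lt_one (by linarith [hQ0 θ])]; linarith [hQ0 θ]
  have hX2 : ∀ θ, -1 < X θ := fun θ => by
    rw [hX, lt_div_iff₀ (by linarith [hQ0 θ])]; linarith
  -- This is `dx/dθ = x'/θ'`, with the common factor `1 - x` cancelled.
  have hXd : ∀ θ, HasDerivAt X ((1 + X θ) * (3 * σ * X θ - (1 + σ) - k * cos θ * (1 - X θ))
      / (2 * k * (lam + sin θ))) θ := fun θ => by
    have hZd : HasDerivAt Z _ θ := ((hasDerivAt_sin θ).const_add lam).mul (hQ θ)
    refine ((hZd.const_sub 1).div (hZd.const_add 1) (hZ1 θ)).congr_deriv ?_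
    have hQZ : Q θ = Z θ / (lam + sin θ) := by rw [hZ]; field_simp [hne θ]
    have h1 := hZ1 θ
    have h2 := hne θ
    simp only [hX]
    rw [hQZ]
    field_simp
    ring
  set f : ℝ → ℝ := fun θ => 2 * k * (1 - X θ) * (lam + sin θ) with hf
  have hf0 : (∀ θ, 0 < f θ) ∨ ∀ θ, f θ < 0 := by
    have h1 : ∀ θ, 0 < lam * f θ := fun θ => by
      have := mul_pos (mul_pos (mul_pos two_pos hk) (sub_pos.2 (hX1 θ))) (hm θ)
      simp only [hf]
      linarith
    rcases lt_or_ge 0 lam with h | h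
    · exact Or.inl fun θ => pos_of_mul_pos_right (h1 θ) h.le
    · exact Or.inr fun θ => neg_of_mul_pos_right (h1 θ) h
  have hfne : ∀ θ, f θ ≠ 0 := fun θ => hf0.elim (fun h => (h θ).ne') fun h => (h θ).ne
  obtain ⟨Θ, G, r, hr, hΘ, hG, hΘG, hGΘ, hGp⟩ := exists_flow_of_ne_zero (f := f) (by fun_prop)
    two_pi_pos (fun θ => by simp only [hf, sin_add_two_pi, hXp θ]) hf0
  have hGn := sub_int_mul_of_add_const hGp
  have hXΘ : ∀ t, X t ^ 2 ≤ 1 := fun t =>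
    (sq_le_one_iff_abs_le_one _).2 (abs_le.2 ⟨(hX2 t).le, (hX1 t).le⟩)
  have hρ : ∀ t, 0 < 1 - X t ^ 2 := fun t =>
    sub_pos.2 ((sq_lt_one_iff_abs_lt_one _).2 (abs_lt.2 ⟨hX2 t, hX1 t⟩))
  set c₁ : ℝ → Vars := fun t => ⟨X (Θ t), 1 - X (Θ t) ^ 2, Θ t⟩ with hc₁
  have hsol : IsSolution σ lam γ c₁ := by
    refine isSolution_of_tilted hγ (fun t => hXΘ _) (fun t => ?_) fun t => hΘ t
    refine ((hXd (Θ t)).comp t (hΘ t)).congr_deriv ?_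
    have := hne (Θ t)
    simp only [hf, ← hkdef]
    field_simp
    ring
  -- The transit time `r` is signed, so time `|r|` is one turn in one direction or the other.
  have hΘr : ∀ t, ∃ n : ℤ, Θ (t + |r|) = Θ t + 2 * π * n := by
    intro t
    rcases abs_choice r with h | h
    · refine ⟨1, ?_⟩
      rw [h, ← hΘG (Θ t + 2 * π * (1 : ℤ)), hGn, hGΘ]
      simp
    · refine ⟨-1, ?_⟩
      rw [h, ← hΘG (Θ t + 2 * π * (-1 : ℤ)), hGn, hGΘ]
      simp
  refine ⟨c₁, |r|, ⟨hsol, abs_pos.2 hr, fun t => ?_, ?_⟩, fun t => ?_, fun c T hc hcV => ?_⟩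
  · obtain ⟨n, hn⟩ := hΘr t
    have hXn : X (Θ t + 2 * π * n) = X (Θ t) := by rw [mul_comm]; exact hXp.int_mul n _
    refine (toState_eq_iff_of_rho_ne_zero (hρ _) (hρ _).le).2 ⟨?_, ?_, n, hn⟩ <;>
      simp only [hc₁, hn, hXn]
  -- At this time the angle has moved by half a turn, which is not a multiple of `2π`.
  · refine ⟨G (Θ 0 + π), fun h => ?_⟩
    obtain ⟨-, -, n, hn⟩ := (toState_eq_iff_of_rho_ne_zero (hρ _) (hρ _).le).1 h
    simp only [hc₁, hΘG] at hn
    have h1 : (1 : ℝ) = 2 * n := by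
      have : π * 1 = π * (2 * n) := by linarith
      exact mul_left_cancel₀ pi_ne_zero this
    have h2 : (1 : ℤ) = 2 * n := by exact_mod_cast h1
    omega
  · exact (mem_extremelyTilted_iff (hρ _).le).2 (by simp [hc₁])
  · have hV : ∀ t, (c t).x ^ 2 + (c t).ρ = 1 := fun t =>
      (mem_extremelyTilted_iff (hc.sol.rho_nonneg t)).1 (hcV t)
    have hcρ := hc.rho_pos_of_tilted hγ hV
    have hx1 := fun t => abs_lt_one_of_tilted (hV t) (hcρ t)
    obtain ⟨n, hn0, hn⟩ := hc.exists_winding hlam hγ hk hV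
    have hcθ := hc.sol.hasDerivAt_theta
    have hprof := profile_eq_of_periodic hσ.2 hlam hk hc.pos hQ hQp (fun t => (hx1 t).1)
      (fun t => (hx1 t).2) (hc.sol.hasDerivAt_x_of_tilted hγ hV) hcθ
      (fun t => ((toState_eq_iff_of_rho_ne_zero (hcρ _) (hcρ _).le).1 (hc.periodic t)).1) hn
    have hxX : ∀ t, (c t).x = X (c t).θ := fun t => by
      have h1 : 1 + (c t).x ≠ 0 := by linarith [(hx1 t).1]
      have h2 := hne (c t).θ
      have h3 : Z (c t).θ = (1 - (c t).x) / (1 + (c t).x) := by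
        simp only [hZ]
        rw [← hprof]
        field_simp
      simp only [hX, h3]
      field_simp
      ring
    -- In the coordinate `G(θ)` the motion on the profile has unit speed; the constant `G (c 0).θ`
    -- becomes the time shift.
    have hGc : ∀ t, HasDerivAt (fun t => G (c t).θ - t) 0 t := fun t => by
      refine (((hG (c t).θ).comp t (hcθ t)).sub (hasDerivAt_id t)).congr_deriv ?_
      rw [hxX t]
      exact sub_eq_zero.2 (inv_mul_cancel₀ (hfne _))
    have hGt : ∀ t, G (c t).θ = t + G (c 0).θ := fun t => by
      have := is_const_of_deriv_eq_zero (fun t => (hGc t).differentiableAt)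
        (fun t => (hGc t).deriv) t 0
      linarith
    refine ⟨n, G (c 0).θ, hn0, hn, ?_, fun t => ?_⟩
    · have h1 := hGt (0 + T)
      rw [hn, hGn] at h1
      have h2 : T = n * r := by linarith
      rw [← abs_mul, ← h2, abs_of_pos hc.pos]
    · have h1 : Θ (t + G (c 0).θ) = (c t).θ := by rw [← hGt, hΘG]
      have h2 : (c t).ρ = 1 - (c t).x ^ 2 := by linarith [hV t]
      simp only [Vars.toState, hc₁, h1, h2, hxX t]

end ReducedTilt

/-- For `Σ₊* ∈ (-1, -1/4)`, `(λ*)² > 1` and `γ ∈ (0, 2)`: the set `V = 1` is an invariant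
2-sphere, it contains exactly one closed periodic orbit, and the periodic solution curves in it
are (up to time translation) this orbit run through `|n|` times, `n` being the winding number
of `θ`. -/
theorem mainTheorem2 (σ lam γ : ℝ) (hσ : σ ∈ Set.Ioo (-1 : ℝ) (-1 / 4)) (hlam : 1 < lam ^ 2)
    (hγ : γ ∈ Set.Ioo (0 : ℝ) 2) :
    Nonempty (ReducedTilt.extremelyTilted ≃ₜ
      Metric.sphere (0 : EuclideanSpace ℝ (Fin 3)) 1) ∧
    (∀ c : ℝ → ReducedTilt.Vars, ReducedTilt.IsSolution σ lam γ c →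
      ∀ τ₀ : ℝ, (c τ₀).toState ∈ ReducedTilt.extremelyTilted →
        ∀ τ : ℝ, (c τ).toState ∈ ReducedTilt.extremelyTilted) ∧
    (∃! O : Set (ℝ × ℂ),
      ReducedTilt.IsClosedOrbit σ lam γ O ∧ O ⊆ ReducedTilt.extremelyTilted) ∧
    (∃ (c₁ : ℝ → ReducedTilt.Vars) (T₁ : ℝ),
      ReducedTilt.IsProperlyPeriodic σ lam γ c₁ T₁ ∧
      (∀ τ : ℝ, (c₁ τ).toState ∈ ReducedTilt.extremelyTilted) ∧
      ∀ (c : ℝ → ReducedTilt.Vars) (T : ℝ),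
        ReducedTilt.IsProperlyPeriodic σ lam γ c T →
        (∀ τ : ℝ, (c τ).toState ∈ ReducedTilt.extremelyTilted) →
        ∃ (n : ℤ) (s : ℝ), n ≠ 0 ∧
          (∀ τ : ℝ, (c (τ + T)).θ = (c τ).θ + 2 * Real.pi * (n : ℝ)) ∧
          T = |(n : ℝ)| * T₁ ∧
          ∀ τ : ℝ, (c τ).toState = (c₁ (τ + s)).toState) := by
  have hex := ReducedTilt.exists_tilted_periodic hσ hlam hγ
  refine ⟨ReducedTilt.nonempty_homeomorph_extremelyTilted, fun c hc t₀ h0 t => ?_, ?_, hex⟩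
  · rw [ReducedTilt.mem_extremelyTilted_iff (hc.rho_nonneg _)] at h0 ⊢
    exact hc.Vsq_eq_one hγ h0 t
  · obtain ⟨c₁, T₁, hc₁, hV₁, huniq⟩ := hex
    refine ⟨Set.range fun t => (c₁ t).toState, ⟨⟨c₁, T₁, hc₁, rfl⟩, Set.range_subset_iff.2 hV₁⟩, ?_⟩
    rintro _ ⟨⟨c, T, hc, rfl⟩, hsub⟩
    obtain ⟨-, s, -, -, -, hs⟩ := huniq c T hc (Set.range_subset_iff.1 hsub)
    simp only [hs]
    exact (Equiv.addRight s).surjective.range_comp fun t => (c₁ t).toState
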